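/- Consider residual ReLU networks of depth $d\ge 1$ and width $h\ge 1$: for weights $w=(W_1,\dots,W_d)$ with $W_l\in\mathbb{R}^{h\times h}$ let $f_w=f_w^d:\mathbb{R}^h\to\mathbb{R}^h$, where $f_w^0(x)=x$ and $f_w^l(x)=W_l\,\phi(f_w^{l-1}(x))+f_w^{l-1}(x)$, with $\phi(t)=\max(t,0)$ applied coordinatewise. Let $\|\cdot\|_2$ and $\|\cdot\|_F$ denote the spectral and Frobenius norms of a matrix, and put $$\Phi^{\mathrm{rn}}(w)=\prod_{l=1}^d(\|W_l\|_2+1)^2\ \sum_{l=1}^d\frac{\|W_l\|_F^2}{(\|W_l\|_2+1)^2},\qquad A_l=\frac{e\sqrt d\,B\prod_{i=1}^d(\|W_i\|_2+1)}{\|W_l\|_2+1}\,I\in\mathbb{R}^{h^2\times h^2}\quad(1\le l\le d).$$ For a distribution $\mathcal D$ of labelled points $(x,y)\in\mathbb{R}^h\times\{1,\dots,h\}$, let $L_\gamma(f)=\mathbb{P}_{(x,y)\sim\mathcal D}\big(f(x)[y]\le\gamma+\max_{j\ne y}f(x)[j]\big)$, and let $\hat L_\gamma(f)$ be the corresponding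 fraction on the training sample. (i) The $A_l$ are sensitivity matrices: for all $w$, all $x$ with $\|x\|_2\le B$, and all perturbations $u=(U_1,\dots,U_d)$ with $\|U_l\|_2\le\frac1d(\|W_l\|_2+1)$ for every $l$, $$\|f_{w+u}(x)-f_w(x)\|_\infty^2\le\sum_{l=1}^d\|A_l\,\mathrm{vec}(U_l)\|_2^2 .$$ (ii) There is an absolute constant $C>0$ such that for all $d,h,m\ge1$, $B\ge0$, $\gamma,\delta>0$ and every distribution $\mathcal D$ with $\|x\|_2\le B$ almost surely, with probability at least $1-\delta$ over $m$ i.i.d. training samples from $\mathcal D$, simultaneously for all weights $w$, $$L_0(f_w)\le\hat L_\gamma(f_w)+C\sqrt{\frac{B^2d^2h^2\,\Phi^{\mathrm{rn}}(w)+\max\{1,\gamma^2\}\,\ln\frac{dm}{\delta}}{\gamma^2m}} .$$ In particular, for $\gamma\le1$ the error term is $\mathcal{O}\Big(\sqrt{\frac{B^2d^2h^2\Phi^{\mathrm{rn}}(w)+\ln(dm/\delta)}{\gamma^2m}}\Big)$ with an absolute implied constant. -/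

import Mathlib

open MeasureTheory
open scoped Matrix

noncomputable section

namespace ResNetBound

/-- The weights `W₁, …, W_d` of a depth `d`, width `h` residual network. The identity skip
connections force every layer, the input and the output to have the same dimension `h`. -/
abbrev Weights (d h : ℕ) : Type := Fin d → Matrix (Fin h) (Fin h) ℝ

/-- Coordinatewise ReLU activation `φ(z) = max(z, 0)`. -/
def relu {h : ℕ} (z : EuclideanSpace ℝ (Fin h)) : Fin h → ℝ := fun i => max (z i) 0

/-- The residual ReLU network: `f⁰(x) = x` and `fˡ(x) = W_l φ(fˡ⁻¹(x)) + fˡ⁻¹(x)`;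
the value is `f^d(x)`. -/
def resNet {h : ℕ} : (d : ℕ) → Weights d h → EuclideanSpace ℝ (Fin h) → EuclideanSpace ℝ (Fin h)
  | 0, _, x => x
  | d + 1, W, x =>
      WithLp.toLp 2 (W (Fin.last d) *ᵥ relu (resNet d (fun i => W i.castSucc) x))
        + resNet d (fun i => W i.castSucc) x

/-- Spectral norm `‖W‖₂`: the operator norm for the Euclidean norm. -/
def specNorm {h : ℕ} (W : Matrix (Fin h) (Fin h) ℝ) : ℝ :=
  ‖Matrix.toEuclideanCLM (n := Fin h) (𝕜 := ℝ) W‖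

/-- Squared Frobenius norm `‖W‖_F²`. -/
def frobSq {h : ℕ} (W : Matrix (Fin h) (Fin h) ℝ) : ℝ := ∑ i, ∑ j, W i j ^ 2

/-- `Φ^rn(w) = ∏_l (‖W_l‖₂ + 1)² · ∑_l ‖W_l‖_F² / (‖W_l‖₂ + 1)²`. -/
def spectralComplexity {d h : ℕ} (W : Weights d h) : ℝ :=
  (∏ l, (specNorm (W l) + 1) ^ 2) * ∑ l, frobSq (W l) / (specNorm (W l) + 1) ^ 2

/-- The diagonal sensitivity matrix
`A_l = (e √d B ∏_i (‖W_i‖₂ + 1) / (‖W_l‖₂ + 1)) I`, of size `h² × h²`. -/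
def sensitivity {d h : ℕ} (B : ℝ) (W : Weights d h) (l : Fin d) :
    Matrix (Fin h × Fin h) (Fin h × Fin h) ℝ :=
  (Real.exp 1 * √(d : ℝ) * B * (∏ i, (specNorm (W i) + 1)) / (specNorm (W l) + 1)) •
    (1 : Matrix (Fin h × Fin h) (Fin h × Fin h) ℝ)

open Classical in
/-- The `0`-`1` margin loss of a score function `f` at a labelled point `(x, y)`: it is `1` if
`f(x)[y] ≤ γ + max_{j ≠ y} f(x)[j]`, that is, if `f(x)[y] ≤ γ + f(x)[j]` for some `j ≠ y`,
and `0` otherwise. -/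
def pointLoss {h : ℕ} (γ : ℝ) (f : EuclideanSpace ℝ (Fin h) → EuclideanSpace ℝ (Fin h))
    (z : EuclideanSpace ℝ (Fin h) × Fin h) : ℝ :=
  if ∃ j, j ≠ z.2 ∧ f z.1 z.2 ≤ γ + f z.1 j then 1 else 0

/-- Expected margin loss `L_γ(f)` under the distribution `D` of labelled points. -/
def expectedLoss {h : ℕ} (D : Measure (EuclideanSpace ℝ (Fin h) × Fin h)) (γ : ℝ)
    (f : EuclideanSpace ℝ (Fin h) → EuclideanSpace ℝ (Fin h)) : ℝ :=
  ∫ z, pointLoss γ f z ∂D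

/-- Empirical margin loss `L̂_γ(f)` on a sample of size `m`. -/
def empiricalLoss {h m : ℕ} (S : Fin m → EuclideanSpace ℝ (Fin h) × Fin h) (γ : ℝ)
    (f : EuclideanSpace ℝ (Fin h) → EuclideanSpace ℝ (Fin h)) : ℝ :=
  (∑ i, pointLoss γ f (S i)) / m

end ResNetBound

end

namespace ResNetBound

/-! ### Layerwise norm and perturbation bounds. -/

section Deterministic

variable {h : ℕ}

/-! Part (i) is a telescoping estimate (`norm_scaledNet_sub_le`) with per-layer growth `1 + 1/d`,
followed by Cauchy–Schwarz over the layers.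

Part (ii) is a compression argument. Put `b = B/γ`, `P = ∏ (‖W_l‖₂ + 1)` and `Q = b(P - 1)`. If `Q ≤
1/4`, the network is within `γ/4` of the identity on the ball, so Hoeffding for that single function
suffices. Otherwise, positive homogeneity lets `P` be pulled out (`scaledNet_mul_smul`), leaving
layers with scaled skips and total norm `1`. Rounding the scale, the defects of the skips from `1`
and the matrix entries to integers moves the output by at most `γ/4` (`norm_codeNet_encode_sub_le`).
An integer `n` costs `|n| + 2` bits. Since `|⌊x⌋| ≤ x² + 2`, the total cost is a sum of squares,
hence of Frobenius norms, plus a constant per parameter. That constant is affordable because `Q >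
1/4` forces `d h² ≤ 16 b² d² h² Φ` (`sum_abs_encode_le`). Hoeffding with a Kraft-weighted union
bound over codes, together with the margin slack, concludes. -/

/-- A residual network whose `l`-th skip connection is scaled by `τ l`. -/
noncomputable def scaledNet : (d : ℕ) → (Fin d → ℝ) → Weights d h →
    EuclideanSpace ℝ (Fin h) → EuclideanSpace ℝ (Fin h)
  | 0, _, _, x => x
  | d + 1, τ, V, x =>
      Matrix.toEuclideanCLM (n := Fin h) (𝕜 := ℝ) (V (Fin.last d))
          (WithLp.toLp 2 (relu (scaledNet d (fun i => τ i.castSucc) (fun i => V i.castSucc) x)))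
        + τ (Fin.last d) • scaledNet d (fun i => τ i.castSucc) (fun i => V i.castSucc) x

theorem norm_relu_sub_relu_le (x y : EuclideanSpace ℝ (Fin h)) :
    ‖(WithLp.toLp 2 (relu x) : EuclideanSpace ℝ (Fin h)) - WithLp.toLp 2 (relu y)‖ ≤ ‖x - y‖ := by
  rw [EuclideanSpace.norm_eq, EuclideanSpace.norm_eq]
  refine Real.sqrt_le_sqrt (Finset.sum_le_sum fun i _ => ?_)
  have := abs_max_sub_max_le_abs (x i) (y i) 0
  simp only [relu, PiLp.sub_apply, Real.norm_eq_abs]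
  gcongr

theorem norm_relu_le (x : EuclideanSpace ℝ (Fin h)) :
    ‖(WithLp.toLp 2 (relu x) : EuclideanSpace ℝ (Fin h))‖ ≤ ‖x‖ := by
  have h0 : (WithLp.toLp 2 (relu (0 : EuclideanSpace ℝ (Fin h))) : EuclideanSpace ℝ (Fin h)) = 0 := by
    ext i
    simp [relu]
  simpa [h0] using norm_relu_sub_relu_le x 0

theorem relu_smul {c : ℝ} (hc : 0 ≤ c) (x : EuclideanSpace ℝ (Fin h)) :
    (WithLp.toLp 2 (relu (c • x)) : EuclideanSpace ℝ (Fin h)) = c • WithLp.toLp 2 (relu x) := by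
  ext i
  simp [relu, mul_max_of_nonneg _ _ hc]

theorem specNorm_nonneg (W : Matrix (Fin h) (Fin h) ℝ) : 0 ≤ specNorm W := norm_nonneg _

theorem frobSq_nonneg (W : Matrix (Fin h) (Fin h) ℝ) : 0 ≤ frobSq W :=
  Finset.sum_nonneg fun _ _ => Finset.sum_nonneg fun _ _ => sq_nonneg _

theorem specNorm_smul (c : ℝ) (W : Matrix (Fin h) (Fin h) ℝ) :
    specNorm (c • W) = |c| * specNorm W := by
  simp [specNorm, norm_smul]

theorem specNorm_add_le (V W : Matrix (Fin h) (Fin h) ℝ) :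
    specNorm (V + W) ≤ specNorm V + specNorm W := by
  simpa [specNorm] using norm_add_le _ _

theorem specNorm_le_sqrt_frobSq (W : Matrix (Fin h) (Fin h) ℝ) : specNorm W ≤ √(frobSq W) := by
  refine ContinuousLinearMap.opNorm_le_bound _ (Real.sqrt_nonneg _) fun x => ?_
  rw [EuclideanSpace.norm_eq, EuclideanSpace.norm_eq, ← Real.sqrt_mul (frobSq_nonneg W)]
  refine Real.sqrt_le_sqrt ?_
  rw [frobSq, Finset.sum_mul]
  refine Finset.sum_le_sum fun i _ => ?_
  simp only [Matrix.ofLp_toEuclideanCLM, Real.norm_eq_abs, sq_abs, Matrix.mulVec, dotProduct]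
  exact Finset.sum_mul_sq_le_sq_mul_sq _ _ _

theorem specNorm_sq_le_frobSq (W : Matrix (Fin h) (Fin h) ℝ) : specNorm W ^ 2 ≤ frobSq W := by
  have := pow_le_pow_left₀ (specNorm_nonneg W) (specNorm_le_sqrt_frobSq W) 2
  rwa [Real.sq_sqrt (frobSq_nonneg W)] at this

theorem norm_scaledNet_le (d : ℕ) (τ : Fin d → ℝ) (V : Weights d h) (α : Fin d → ℝ)
    (hα : ∀ l, specNorm (V l) + |τ l| ≤ α l) (x : EuclideanSpace ℝ (Fin h)) :
    ‖scaledNet d τ V x‖ ≤ (∏ l, α l) * ‖x‖ := by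
  induction d with
  | zero => simp [scaledNet]
  | succ d ih =>
    have ih' := ih (fun i => τ i.castSucc) (fun i => V i.castSucc) (fun i => α i.castSucc)
      fun l => hα l.castSucc
    have hpos : 0 ≤ α (Fin.last d) :=
      (add_nonneg (specNorm_nonneg _) (abs_nonneg _)).trans (hα (Fin.last d))
    rw [Fin.prod_univ_castSucc, scaledNet]
    set y := scaledNet d (fun i => τ i.castSucc) (fun i => V i.castSucc) x
    calc _ ≤ specNorm (V (Fin.last d)) * ‖y‖ + |τ (Fin.last d)| * ‖y‖ := by
          refine (norm_add_le _ _).trans (add_le_add ?_ (norm_smul _ _).le)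
          refine (ContinuousLinearMap.le_opNorm _ _).trans ?_
          exact mul_le_mul_of_nonneg_left (norm_relu_le y) (norm_nonneg _)
      _ = (specNorm (V (Fin.last d)) + |τ (Fin.last d)|) * ‖y‖ := by ring
      _ ≤ α (Fin.last d) * ((∏ i : Fin d, α i.castSucc) * ‖x‖) := by
          gcongr
          exact hα _
      _ = _ := by ring

/-- Induction on depth: a perturbed layer has Lipschitz constant at most `(1 + ζ) α`, and it acts on
the error made so far; the change of the layer itself acts on the unperturbed activation. Skips may
vary too, because the quantization rounds them. -/
theorem norm_scaledNet_sub_le (d : ℕ) (τ τ' : Fin d → ℝ) (V V' : Weights d h) (α κ : Fin d → ℝ)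
    {ζ : ℝ} (hζ : 0 ≤ ζ) (hα0 : ∀ l, 0 < α l) (hα : ∀ l, specNorm (V l) + |τ l| ≤ α l)
    (hκ : ∀ l, specNorm (V' l - V l) + |τ' l - τ l| ≤ κ l) (hκζ : ∀ l, κ l ≤ ζ * α l)
    (x : EuclideanSpace ℝ (Fin h)) :
    ‖scaledNet d τ' V' x - scaledNet d τ V x‖
      ≤ (1 + ζ) ^ d * ((∏ l, α l) * ((∑ l, κ l / α l) * ‖x‖)) := by
  induction d with
  | zero => simp [scaledNet]
  | succ d ih =>
    have ih' := ih (fun i => τ i.castSucc) (fun i => τ' i.castSucc) (fun i => V i.castSucc)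
      (fun i => V' i.castSucc) (fun i => α i.castSucc) (fun i => κ i.castSucc)
      (fun l => hα0 l.castSucc) (fun l => hα l.castSucc) (fun l => hκ l.castSucc)
      fun l => hκζ l.castSucc
    have hy := norm_scaledNet_le d (fun i => τ i.castSucc) (fun i => V i.castSucc)
      (fun i => α i.castSucc) (fun l => hα l.castSucc) x
    rw [Fin.prod_univ_castSucc, Fin.sum_univ_castSucc, scaledNet, scaledNet]
    set y := scaledNet d (fun i => τ i.castSucc) (fun i => V i.castSucc) x
    set y' := scaledNet d (fun i => τ' i.castSucc) (fun i => V' i.castSucc) x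
    set p := ∏ i : Fin d, α i.castSucc
    set s := ∑ i : Fin d, κ i.castSucc / α i.castSucc
    have hl0 := hα0 (Fin.last d)
    have hl := hα (Fin.last d)
    have hk := hκ (Fin.last d)
    have hkz := hκζ (Fin.last d)
    set a := α (Fin.last d)
    set k := κ (Fin.last d)
    set v := V (Fin.last d)
    set v' := V' (Fin.last d)
    set t := τ (Fin.last d)
    set t' := τ' (Fin.last d)
    have hk0 : 0 ≤ k := (add_nonneg (specNorm_nonneg _) (abs_nonneg _)).trans hk
    have hp : 0 ≤ p := Finset.prod_nonneg fun i _ => (hα0 _).le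
    have hv' : specNorm v' + |t'| ≤ (1 + ζ) * a := by
      have h1 : specNorm v' ≤ specNorm (v' - v) + specNorm v := by
        simpa using specNorm_add_le (v' - v) v
      have h2 : |t'| ≤ |t' - t| + |t| := by simpa using abs_add_le (t' - t) t
      linarith
    set R : EuclideanSpace ℝ (Fin h) → EuclideanSpace ℝ (Fin h) := fun z => WithLp.toLp 2 (relu z)
    set T := Matrix.toEuclideanCLM (n := Fin h) (𝕜 := ℝ)
    have hdecomp : T v' (R y') + t' • y' - (T v (R y) + t • y)
        = (T v' (R y' - R y) + t' • (y' - y)) + (T (v' - v) (R y) + (t' - t) • y) := by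
      simp only [map_sub, _root_.sub_apply, smul_sub, sub_smul]
      abel
    calc ‖T v' (R y') + t' • y' - (T v (R y) + t • y)‖
        ≤ (specNorm v' * ‖y' - y‖ + |t'| * ‖y' - y‖)
          + (specNorm (v' - v) * ‖y‖ + |t' - t| * ‖y‖) := by
          rw [hdecomp]
          refine (norm_add_le _ _).trans (add_le_add ?_ ?_)
          · refine (norm_add_le _ _).trans (add_le_add ?_ (norm_smul _ _).le)
            refine (ContinuousLinearMap.le_opNorm _ _).trans ?_
            exact mul_le_mul_of_nonneg_left (norm_relu_sub_relu_le y' y) (norm_nonneg _)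
          · refine (norm_add_le _ _).trans (add_le_add ?_ (norm_smul _ _).le)
            refine (ContinuousLinearMap.le_opNorm _ _).trans ?_
            exact mul_le_mul_of_nonneg_left (norm_relu_le y) (norm_nonneg _)
      _ = (specNorm v' + |t'|) * ‖y' - y‖ + (specNorm (v' - v) + |t' - t|) * ‖y‖ := by ring
      _ ≤ (1 + ζ) * a * ((1 + ζ) ^ d * (p * (s * ‖x‖))) + k * (p * ‖x‖) := by
          gcongr
      -- The new term is enlarged so that both terms share the factor `(1 + ζ) ^ (d + 1)`.
      _ ≤ (1 + ζ) * a * ((1 + ζ) ^ d * (p * (s * ‖x‖)))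
          + (1 + ζ) ^ (d + 1) * (k * (p * ‖x‖)) := by
          refine add_le_add le_rfl ?_
          exact le_mul_of_one_le_left (mul_nonneg hk0 (mul_nonneg hp (norm_nonneg _)))
            (one_le_pow₀ (by linarith))
      _ = (1 + ζ) ^ (d + 1) * (p * a * ((s + k / a) * ‖x‖)) := by
          field_simp
          ring

theorem resNet_eq_scaledNet (d : ℕ) (W : Weights d h) : resNet d W = scaledNet d 1 W := by
  induction d with
  | zero => rfl
  | succ d ih =>
    funext x
    rw [resNet, scaledNet, ih, show (fun i : Fin d => (1 : Fin (d + 1) → ℝ) i.castSucc) = 1 from rfl,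
      Pi.one_apply, one_smul]
    rfl

/-- ReLU is positively homogeneous, so a nonnegative factor common to a layer's matrix and its skip
passes through to the output. -/
theorem scaledNet_mul_smul (d : ℕ) (c τ : Fin d → ℝ) (V : Weights d h) (hc : ∀ l, 0 ≤ c l)
    (x : EuclideanSpace ℝ (Fin h)) :
    scaledNet d (fun l => c l * τ l) (fun l => c l • V l) x = (∏ l, c l) • scaledNet d τ V x := by
  induction d with
  | zero => simp [scaledNet]
  | succ d ih =>
    have hp : 0 ≤ ∏ i : Fin d, c i.castSucc := Finset.prod_nonneg fun i _ => hc _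
    simp only [scaledNet]
    rw [ih (fun i => c i.castSucc) (fun i => τ i.castSucc) (fun i => V i.castSucc)
      fun i => hc _, relu_smul hp, Fin.prod_univ_castSucc]
    simp only [map_smul, smul_add, smul_smul, _root_.smul_apply]
    congr 2
    ring

theorem norm_resNet_sub_self_le (d : ℕ) (W : Weights d h) (x : EuclideanSpace ℝ (Fin h)) :
    ‖resNet d W x - x‖ ≤ ((∏ l, (specNorm (W l) + 1)) - 1) * ‖x‖ := by
  induction d with
  | zero => simp [resNet]
  | succ d ih =>
    have ih' := ih fun i => W i.castSucc
    have hy := norm_scaledNet_le d 1 (fun i => W i.castSucc)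
      (fun i => specNorm (W i.castSucc) + 1) (fun l => by simp) x
    rw [← resNet_eq_scaledNet] at hy
    rw [Fin.prod_univ_castSucc, resNet]
    set y := resNet d (fun i => W i.castSucc) x
    have h1 : ‖(WithLp.toLp 2 (W (Fin.last d) *ᵥ relu y) : EuclideanSpace ℝ (Fin h))‖
        ≤ specNorm (W (Fin.last d)) * ‖y‖ :=
      (ContinuousLinearMap.le_opNorm (Matrix.toEuclideanCLM (n := Fin h) (𝕜 := ℝ) (W (Fin.last d)))
        (WithLp.toLp 2 (relu y))).trans
        (mul_le_mul_of_nonneg_left (norm_relu_le y) (norm_nonneg _))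
    have h2 := mul_le_mul_of_nonneg_left hy (specNorm_nonneg (W (Fin.last d)))
    rw [add_sub_assoc]
    refine (norm_add_le _ _).trans ?_
    linarith

theorem continuous_scaledNet (d : ℕ) (τ : Fin d → ℝ) (V : Weights d h) :
    Continuous (scaledNet d τ V) := by
  induction d with
  | zero => exact continuous_id
  | succ d ih =>
    have ih' := ih (fun i => τ i.castSucc) fun i => V i.castSucc
    simp only [scaledNet]
    refine Continuous.add ((ContinuousLinearMap.continuous _).comp ?_) (ih'.const_smul (τ (Fin.last d)))
    refine (PiLp.continuous_toLp 2 _).comp (continuous_pi fun i => ?_)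
    simp only [relu]
    fun_prop

theorem one_add_inv_pow_le_exp (d : ℕ) : (1 + (d : ℝ)⁻¹) ^ d ≤ Real.exp 1 := by
  rcases Nat.eq_zero_or_pos d with rfl | hd
  · simp
  calc (1 + (d : ℝ)⁻¹) ^ d ≤ Real.exp ((d : ℝ)⁻¹) ^ d := by
        gcongr
        linarith [Real.add_one_le_exp ((d : ℝ)⁻¹)]
    _ = Real.exp 1 := by
        rw [← Real.exp_nat_mul, mul_inv_cancel₀ (by positivity)]

theorem norm_sq_smul_one_mulVec_vec (c : ℝ) (U : Matrix (Fin h) (Fin h) ℝ) :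
    ‖(WithLp.toLp 2 ((c • (1 : Matrix (Fin h × Fin h) (Fin h × Fin h) ℝ)) *ᵥ Matrix.vec U) :
      EuclideanSpace ℝ (Fin h × Fin h))‖ ^ 2 = c ^ 2 * frobSq U := by
  rw [EuclideanSpace.norm_sq_eq, frobSq, Fintype.sum_prod_type, Finset.sum_comm]
  simp [Matrix.smul_mulVec, Matrix.vec, mul_pow, Finset.mul_sum]

/-- The matrices `sensitivity B W l` bound the effect of small layerwise perturbations. -/
theorem sq_abs_resNet_add_sub_le (d h : ℕ) (B : ℝ) (W U : Weights d h)
    (hU : ∀ l, specNorm (U l) ≤ (specNorm (W l) + 1) / d) (x : EuclideanSpace ℝ (Fin h))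
    (hx : ‖x‖ ≤ B) (k : Fin h) :
    |resNet d (W + U) x k - resNet d W x k| ^ 2 ≤
      ∑ l, ‖(WithLp.toLp 2 (sensitivity B W l *ᵥ Matrix.vec (U l)) :
        EuclideanSpace ℝ (Fin h × Fin h))‖ ^ 2 := by
  have ha : ∀ l, 0 < specNorm (W l) + 1 := fun l => by linarith [specNorm_nonneg (W l)]
  have hP : 0 ≤ ∏ l, (specNorm (W l) + 1) := Finset.prod_nonneg fun l _ => (ha l).le
  have hpert := norm_scaledNet_sub_le d 1 1 W (W + U) (fun l => specNorm (W l) + 1)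
    (fun l => specNorm (U l)) (ζ := (d : ℝ)⁻¹) (by positivity) ha (fun l => by simp)
    (fun l => by simp) (fun l => by simpa [div_eq_inv_mul] using hU l) x
  rw [← resNet_eq_scaledNet, ← resNet_eq_scaledNet] at hpert
  set P := ∏ l, (specNorm (W l) + 1)
  have hs : 0 ≤ ∑ l, specNorm (U l) / (specNorm (W l) + 1) :=
    Finset.sum_nonneg fun l _ => div_nonneg (specNorm_nonneg _) (ha l).le
  have h1 : |resNet d (W + U) x k - resNet d W x k|
      ≤ Real.exp 1 * (P * ((∑ l, specNorm (U l) / (specNorm (W l) + 1)) * B)) := by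
    have hk := PiLp.norm_apply_le (resNet d (W + U) x - resNet d W x) k
    rw [PiLp.sub_apply, Real.norm_eq_abs] at hk
    refine hk.trans (hpert.trans ?_)
    gcongr
    exact one_add_inv_pow_le_exp d
  -- Cauchy–Schwarz over the layers: the source of `√d` in `A_l`.
  have hcs : (∑ l, specNorm (U l) / (specNorm (W l) + 1)) ^ 2
      ≤ d * ∑ l, (specNorm (U l) / (specNorm (W l) + 1)) ^ 2 := by
    simpa using sq_sum_le_card_mul_sum_sq (s := (Finset.univ : Finset (Fin d)))
      (f := fun l => specNorm (U l) / (specNorm (W l) + 1))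
  calc |resNet d (W + U) x k - resNet d W x k| ^ 2
      ≤ (Real.exp 1 * (P * ((∑ l, specNorm (U l) / (specNorm (W l) + 1)) * B))) ^ 2 := by gcongr
    _ = (Real.exp 1 * P * B) ^ 2 * (∑ l, specNorm (U l) / (specNorm (W l) + 1)) ^ 2 := by ring
    _ ≤ (Real.exp 1 * P * B) ^ 2 * (d * ∑ l, (specNorm (U l) / (specNorm (W l) + 1)) ^ 2) := by
        gcongr
    _ ≤ ∑ l, ‖(WithLp.toLp 2 (sensitivity B W l *ᵥ Matrix.vec (U l)) :
        EuclideanSpace ℝ (Fin h × Fin h))‖ ^ 2 := by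
        simp only [Finset.mul_sum]
        refine Finset.sum_le_sum fun l _ => ?_
        rw [sensitivity, norm_sq_smul_one_mulVec_vec]
        have hd' : √(d : ℝ) ^ 2 = d := Real.sq_sqrt (by positivity)
        calc _ = (Real.exp 1 * P * B) ^ 2 * d / (specNorm (W l) + 1) ^ 2 * specNorm (U l) ^ 2 := by
              rw [div_pow]
              ring
          _ ≤ (Real.exp 1 * P * B) ^ 2 * d / (specNorm (W l) + 1) ^ 2 * frobSq (U l) := by
              gcongr
              exact specNorm_sq_le_frobSq _
          _ = _ := by
              have : (Real.exp 1 * √(d : ℝ) * B * P) ^ 2 = (Real.exp 1 * P * B) ^ 2 * d := by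
                rw [← congrArg ((Real.exp 1 * P * B) ^ 2 * ·) hd']
                ring
              rw [div_pow, this]

end Deterministic

/-! ### Integer codes for networks: accuracy and length. -/

section Quantization

variable {d h : ℕ}

/-- Index set of the integer parameters describing a quantized network: the overall scale, the
skip coefficients and the matrix entries. -/
abbrev CodeIndex (d h : ℕ) : Type := Unit ⊕ Fin d ⊕ (Fin d × Fin h × Fin h)

/-- The quantized overall scale of a code, relative to `b`. -/
noncomputable def codeScale (b : ℝ) (c : CodeIndex d h → ℤ) : ℝ := b + c (Sum.inl ()) / 8

/-- The quantized network described by an integer code. -/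
noncomputable def codeNet (b : ℝ) (c : CodeIndex d h → ℤ) :
    EuclideanSpace ℝ (Fin h) → EuclideanSpace ℝ (Fin h) := fun x =>
  -- The mesh depends on the scale, which the decoder reads from the code itself. Skips are coded by
  -- their defect from `1`, so a layer with small weights is cheap.
  (codeScale b c / b) • scaledNet d
    (fun l => 1 - c (Sum.inr (Sum.inl l)) * (48 * codeScale b c * d)⁻¹)
    (fun l => Matrix.of fun i j =>
      c (Sum.inr (Sum.inr (l, i, j))) * ((48 * codeScale b c * d)⁻¹ / h)) x

theorem continuous_codeNet (b : ℝ) (c : CodeIndex d h → ℤ) : Continuous (codeNet b c) :=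
  (continuous_scaledNet d _ _).const_smul (codeScale b c / b)

/-- Converts code length, which is linear in the integers, into squares that sum to Frobenius norms.
-/
theorem abs_floor_le_sq_add_two (x : ℝ) : ((|⌊x⌋| : ℤ) : ℝ) ≤ x ^ 2 + 2 := by
  have h1 := Int.floor_le x
  have h2 := Int.lt_floor_add_one x
  rw [Int.cast_abs, abs_le]
  constructor <;> nlinarith [sq_nonneg (x + 1), sq_nonneg (x - 1), sq_nonneg x]

theorem abs_floor_mul_sub_le {v η : ℝ} (hη : 0 < η) : |(⌊v / η⌋ : ℝ) * η - v| ≤ η := by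
  have h1 := Int.floor_le (v / η)
  have h2 := Int.lt_floor_add_one (v / η)
  rw [le_div_iff₀ hη] at h1
  rw [div_lt_iff₀ hη] at h2
  rw [abs_le]
  constructor <;> nlinarith

theorem specNorm_le_of_forall_abs_le (M : Matrix (Fin h) (Fin h) ℝ) {η : ℝ} (hη : 0 ≤ η)
    (hM : ∀ i j, |M i j| ≤ η) : specNorm M ≤ h * η := by
  refine (specNorm_le_sqrt_frobSq M).trans (Real.sqrt_le_iff.2 ⟨by positivity, ?_⟩)
  calc frobSq M ≤ ∑ _i : Fin h, ∑ _j : Fin h, η ^ 2 := by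
        refine Finset.sum_le_sum fun i _ => Finset.sum_le_sum fun j _ => ?_
        rw [← sq_abs]
        gcongr
        exact hM i j
    _ = (h * η) ^ 2 := by
        simp
        ring

theorem one_sub_inv_prod_le_sum {ι : Type*} (s : Finset ι) (a : ι → ℝ) (ha : ∀ i, 1 ≤ a i) :
    1 - (∏ i ∈ s, a i)⁻¹ ≤ ∑ i ∈ s, (1 - (a i)⁻¹) := by
  classical
  induction s using Finset.induction_on with
  | empty => simp
  | insert i s hi ih =>
    rw [Finset.prod_insert hi, Finset.sum_insert hi, mul_inv]
    have h1 : (a i)⁻¹ ≤ 1 := inv_le_one_of_one_le₀ (ha i)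
    have h2 : (∏ i ∈ s, a i)⁻¹ ≤ 1 :=
      inv_le_one_of_one_le₀ (Finset.prod_induction _ (1 ≤ ·)
        (fun _ _ => one_le_mul_of_one_le_of_one_le) le_rfl fun i _ => ha i)
    nlinarith

/-- A deviation of the product of norms from `1` is controlled by the spectral complexity. -/
theorem sq_mul_prod_sub_one_le (b : ℝ) (W : Weights d h) :
    (b * ((∏ l, (specNorm (W l) + 1)) - 1)) ^ 2 ≤ b ^ 2 * d * spectralComplexity W := by
  have ha : ∀ l, 1 ≤ specNorm (W l) + 1 := fun l => by linarith [specNorm_nonneg (W l)]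
  have hP : 1 ≤ ∏ l, (specNorm (W l) + 1) :=
    Finset.prod_induction _ (1 ≤ ·) (fun _ _ => one_le_mul_of_one_le_of_one_le) le_rfl
      fun l _ => ha l
  have hsum := one_sub_inv_prod_le_sum Finset.univ _ ha
  rw [spectralComplexity, Finset.prod_pow]
  set P := ∏ l, (specNorm (W l) + 1)
  -- `1 - P⁻¹` is subadditive over the layers, and each layer contributes `‖W_l‖₂ / (‖W_l‖₂ + 1)`, a
  -- term visible to `Φ`.
  have hP1 : P - 1 = P * (1 - P⁻¹) := by
    have : P ≠ 0 := by positivity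
    field_simp
  have hcs : (∑ l, (1 - (specNorm (W l) + 1)⁻¹)) ^ 2
      ≤ d * ∑ l, (1 - (specNorm (W l) + 1)⁻¹) ^ 2 := by
    simpa using sq_sum_le_card_mul_sum_sq (s := (Finset.univ : Finset (Fin d)))
      (f := fun l => 1 - (specNorm (W l) + 1)⁻¹)
  have hfrob : ∑ l, (1 - (specNorm (W l) + 1)⁻¹) ^ 2
      ≤ ∑ l, frobSq (W l) / (specNorm (W l) + 1) ^ 2 := by
    refine Finset.sum_le_sum fun l _ => ?_
    have h0 : specNorm (W l) + 1 ≠ 0 := by linarith [ha l]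
    have : 1 - (specNorm (W l) + 1)⁻¹ = specNorm (W l) / (specNorm (W l) + 1) := by
      field_simp
      ring
    rw [this, div_pow]
    gcongr
    exact specNorm_sq_le_frobSq _
  have hinv : 0 ≤ 1 - P⁻¹ := sub_nonneg.2 (inv_le_one_of_one_le₀ hP)
  calc (b * (P - 1)) ^ 2 = b ^ 2 * P ^ 2 * (1 - P⁻¹) ^ 2 := by
        rw [hP1]
        ring
    _ ≤ b ^ 2 * P ^ 2 * (∑ l, (1 - (specNorm (W l) + 1)⁻¹)) ^ 2 := by gcongr
    _ ≤ b ^ 2 * P ^ 2 * (d * ∑ l, frobSq (W l) / (specNorm (W l) + 1) ^ 2) := by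
        gcongr
        exact hcs.trans (by gcongr)
    _ = _ := by ring

theorem sum_abs_floor_skip_le (W : Weights d h) {X : ℝ} (hX : 0 < X) (hd : 1 ≤ d) :
    ∑ l : Fin d, (((|⌊(1 - (specNorm (W l) + 1)⁻¹) / (48 * X * d)⁻¹⌋| : ℤ) : ℝ) + 2) ≤
      2304 * (X ^ 2 * d ^ 2 * ∑ l, frobSq (W l) / (specNorm (W l) + 1) ^ 2) + 4 * d := by
  have hd' : (d : ℝ) ≠ 0 := by positivity
  -- `2304 = 48²` comes from the mesh; `4` is `2` from the floor bound plus `2` from the code.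
  calc _ ≤ ∑ l : Fin d, (2304 * X ^ 2 * d ^ 2 * (frobSq (W l) / (specNorm (W l) + 1) ^ 2)
          + 4) := by
        refine Finset.sum_le_sum fun l _ => ?_
        have h1 := abs_floor_le_sq_add_two ((1 - (specNorm (W l) + 1)⁻¹) / (48 * X * d)⁻¹)
        have h0 : specNorm (W l) + 1 ≠ 0 := by linarith [specNorm_nonneg (W l)]
        have h2 : ((1 - (specNorm (W l) + 1)⁻¹) / (48 * X * d)⁻¹) ^ 2
            = 2304 * X ^ 2 * d ^ 2 * (specNorm (W l) ^ 2 / (specNorm (W l) + 1) ^ 2) := by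
          field_simp
          ring
        have h3 : 2304 * X ^ 2 * d ^ 2 * (specNorm (W l) ^ 2 / (specNorm (W l) + 1) ^ 2)
            ≤ 2304 * X ^ 2 * d ^ 2 * (frobSq (W l) / (specNorm (W l) + 1) ^ 2) := by
          gcongr
          exact specNorm_sq_le_frobSq _
        linarith
    _ = _ := by
        rw [Finset.sum_add_distrib, ← Finset.mul_sum]
        simp
        ring

theorem sum_abs_floor_entry_le (W : Weights d h) {X : ℝ} (hX : 0 < X) (hd : 1 ≤ d) (hh : 1 ≤ h) :
    ∑ q : Fin d × Fin h × Fin h,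
        (((|⌊((specNorm (W q.1) + 1)⁻¹ * W q.1 q.2.1 q.2.2) / ((48 * X * d)⁻¹ / h)⌋| : ℤ) : ℝ) + 2) ≤
      2304 * (X ^ 2 * d ^ 2 * h ^ 2 * ∑ l, frobSq (W l) / (specNorm (W l) + 1) ^ 2)
        + 4 * (d * h ^ 2) := by
  have hd' : (d : ℝ) ≠ 0 := by positivity
  have hh' : (h : ℝ) ≠ 0 := by positivity
  calc _ ≤ ∑ q : Fin d × Fin h × Fin h, (2304 * X ^ 2 * d ^ 2 * h ^ 2 *
          (W q.1 q.2.1 q.2.2 ^ 2 / (specNorm (W q.1) + 1) ^ 2) + 4) := by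
        refine Finset.sum_le_sum fun q _ => ?_
        have h1 := abs_floor_le_sq_add_two
          (((specNorm (W q.1) + 1)⁻¹ * W q.1 q.2.1 q.2.2) / ((48 * X * d)⁻¹ / h))
        have h0 : specNorm (W q.1) + 1 ≠ 0 := by linarith [specNorm_nonneg (W q.1)]
        have h2 : (((specNorm (W q.1) + 1)⁻¹ * W q.1 q.2.1 q.2.2) / ((48 * X * d)⁻¹ / h)) ^ 2
            = 2304 * X ^ 2 * d ^ 2 * h ^ 2 *
              (W q.1 q.2.1 q.2.2 ^ 2 / (specNorm (W q.1) + 1) ^ 2) := by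
          field_simp
          ring
        linarith
    _ = _ := by
        rw [Finset.sum_add_distrib, ← Finset.mul_sum]
        simp only [Fintype.sum_prod_type, frobSq, Finset.sum_div]
        simp
        ring

/-- The quantized overall scale of `W`, measured in units of `1 / 8`. -/
noncomputable def roundedScale (b : ℝ) (W : Weights d h) : ℤ :=
  ⌈8 * (b * ((∏ l, (specNorm (W l) + 1)) - 1))⌉

/-- The integer code of `W`: all parameters of the normalized network, rounded to a grid. -/
noncomputable def encode (b : ℝ) (W : Weights d h) : CodeIndex d h → ℤ
  | Sum.inl _ => roundedScale b W
  | Sum.inr (Sum.inl l) =>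
      ⌊(1 - (specNorm (W l) + 1)⁻¹) / (48 * (b + roundedScale b W / 8) * d)⁻¹⌋
  | Sum.inr (Sum.inr q) =>
      ⌊((specNorm (W q.1) + 1)⁻¹ * W q.1 q.2.1 q.2.2) /
        ((48 * (b + roundedScale b W / 8) * d)⁻¹ / h)⌋

/-- A network that is far from the identity is close to its quantization. -/
theorem norm_codeNet_encode_sub_le (hd : 1 ≤ d) (hh : 1 ≤ h) {B γ : ℝ} (hB : 0 ≤ B) (hγ : 0 < γ)
    (W : Weights d h) (hW : 1 / 4 < B / γ * ((∏ l, (specNorm (W l) + 1)) - 1))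
    (x : EuclideanSpace ℝ (Fin h)) (hx : ‖x‖ ≤ B) :
    ‖codeNet (B / γ) (encode (B / γ) W) x - resNet d W x‖ ≤ γ / 4 := by
  have ha0 : ∀ l, 0 < specNorm (W l) + 1 := fun l => by linarith [specNorm_nonneg (W l)]
  have hd' : (1 : ℝ) ≤ d := by exact_mod_cast hd
  have hh' : (1 : ℝ) ≤ h := by exact_mod_cast hh
  have hb : 0 ≤ B / γ := by positivity
  have hBγ : B = B / γ * γ := by field_simp
  set b := B / γ with hbdef
  set P := ∏ l, (specNorm (W l) + 1) with hPdef
  have hP : 0 < P := Finset.prod_pos fun l _ => ha0 l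
  have hb0 : 0 < b := by
    rcases hb.eq_or_lt with h0 | h0
    · rw [← h0] at hW
      norm_num at hW
    · exact h0
  set Q := b * (P - 1) with hQdef
  have hk1 : 8 * Q ≤ roundedScale b W := Int.le_ceil _
  have hk2 : (roundedScale b W : ℝ) < 8 * Q + 1 := Int.ceil_lt_add_one _
  set k := roundedScale b W with hkdef
  set X := b + (k : ℝ) / 8 with hXdef
  have hXP : b * P ≤ X := by
    rw [hXdef]
    linarith
  have hXP' : X ≤ b * P + 1 / 8 := by
    rw [hXdef]
    linarith
  have hX4 : 1 / 4 < X := by linarith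
  set θ := (48 * X * d)⁻¹ with hθdef
  have hθ : 0 < θ := by positivity
  have hθh : 0 < θ / h := by positivity
  set c := encode b W with hcdef
  set τ : Fin d → ℝ := fun l => (specNorm (W l) + 1)⁻¹ with hτ
  set V : Weights d h := fun l => (specNorm (W l) + 1)⁻¹ • W l with hV
  have hres : resNet d W x = P • scaledNet d τ V x := by
    rw [resNet_eq_scaledNet, hPdef, ← scaledNet_mul_smul d _ _ _ fun l => (ha0 l).le]
    congr 1
    · funext l
      simp [hτ, (ha0 l).ne']
    · funext l
      simp [hV, smul_smul, (ha0 l).ne']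
  -- After normalization every layer has matrix norm plus skip equal to `1`, so one mesh serves all
  -- layers.
  have hα : ∀ l, specNorm (V l) + |τ l| ≤ 1 := fun l => by
    rw [hV, hτ, specNorm_smul, abs_of_pos (inv_pos.2 (ha0 l))]
    have : specNorm (W l) + 1 ≠ 0 := (ha0 l).ne'
    apply le_of_eq
    field_simp
  set τ' : Fin d → ℝ := fun l => 1 - c (Sum.inr (Sum.inl l)) * θ with hτ'
  set V' : Weights d h := fun l => Matrix.of fun i j =>
    c (Sum.inr (Sum.inr (l, i, j))) * (θ / h) with hV'
  have hτd : ∀ l, |τ' l - τ l| ≤ θ := fun l => by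
    have := abs_floor_mul_sub_le (v := 1 - (specNorm (W l) + 1)⁻¹) hθ
    rw [abs_sub_comm] at this
    convert this using 2
    simp only [hτ', hτ, hcdef, encode]
    ring
  have hVd : ∀ l, specNorm (V' l - V l) ≤ θ := fun l => by
    have := specNorm_le_of_forall_abs_le (V' l - V l) hθh.le fun i j =>
      abs_floor_mul_sub_le (v := (specNorm (W l) + 1)⁻¹ * W l i j) hθh
    rwa [mul_div_cancel₀ _ (by positivity)] at this
  -- Skip and matrix each move by at most `θ`; `X > 1/4` keeps their sum below `1/d`, so the
  -- accumulated growth stays below `e ≤ 3`.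
  have hθd : 2 * θ ≤ (d : ℝ)⁻¹ * 1 := by
    rw [hθdef, mul_inv, mul_one, ← mul_assoc]
    refine mul_le_of_le_one_left (by positivity) ?_
    rw [mul_inv_le_iff₀ (by positivity)]
    linarith
  have hpert := norm_scaledNet_sub_le d τ τ' V V' (fun _ => 1) (fun _ => 2 * θ)
    (ζ := (d : ℝ)⁻¹) (by positivity) (fun _ => one_pos) hα
    (fun l => by linarith [hτd l, hVd l]) (fun _ => hθd) x
  have hnorm := norm_scaledNet_le d τ V (fun _ => 1) hα x
  simp only [Finset.prod_const_one, one_mul, div_one, Finset.sum_const, Finset.card_univ,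
    Fintype.card_fin, nsmul_eq_mul] at hpert hnorm
  have he : (1 + (d : ℝ)⁻¹) ^ d ≤ 3 :=
    (one_add_inv_pow_le_exp d).trans (Real.exp_one_lt_d9.le.trans (by norm_num))
  have hpert' : ‖scaledNet d τ' V' x - scaledNet d τ V x‖ ≤ 3 * (d * (2 * θ) * B) :=
    hpert.trans (by gcongr)
  have hcode : codeNet b c x = (X / b) • scaledNet d τ' V' x := rfl
  have hdecomp : codeNet b c x - resNet d W x
      = (X / b) • (scaledNet d τ' V' x - scaledNet d τ V x) + (X / b - P) • scaledNet d τ V x := by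
    rw [hcode, hres, smul_sub, sub_smul]
    abel
  have hXb : 0 ≤ X / b - P := by
    rw [sub_nonneg, le_div_iff₀ hb0]
    linarith
  calc ‖codeNet b c x - resNet d W x‖
      ≤ X / b * (3 * (d * (2 * θ) * B)) + (X / b - P) * B := by
        rw [hdecomp]
        refine (norm_add_le _ _).trans (add_le_add ?_ ?_)
        · rw [norm_smul, Real.norm_of_nonneg (by positivity)]
          gcongr
        · rw [norm_smul, Real.norm_of_nonneg hXb]
          gcongr
          exact hnorm.trans hx
    -- The `48` in the mesh makes parameter rounding cost exactly `γ/8`. The scale, rounded up in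
    -- units of `1/8`, costs at most another `γ/8`.
    _ = γ / 8 + (X - b * P) * γ := by
        rw [hBγ, hθdef]
        field_simp
        ring
    _ ≤ γ / 4 := by nlinarith

/-- The code of a network that is far from the identity is short compared to the spectral
complexity. -/
theorem sum_abs_encode_le (hd : 1 ≤ d) (hh : 1 ≤ h) {b : ℝ} (hb : 0 ≤ b)
    (W : Weights d h) (hW : 1 / 4 < b * ((∏ l, (specNorm (W l) + 1)) - 1)) :
    ∑ j, (((|encode b W j| : ℤ) : ℝ) + 2) ≤
      20000 * (b ^ 2 * d ^ 2 * h ^ 2 * spectralComplexity W) := by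
  have ha0 : ∀ l, 0 < specNorm (W l) + 1 := fun l => by linarith [specNorm_nonneg (W l)]
  have hd' : (1 : ℝ) ≤ d := by exact_mod_cast hd
  have hh' : (1 : ℝ) ≤ h := by exact_mod_cast hh
  have hQsq := sq_mul_prod_sub_one_le b W
  have hΦ : spectralComplexity W = (∏ l, (specNorm (W l) + 1)) ^ 2 *
      ∑ l, frobSq (W l) / (specNorm (W l) + 1) ^ 2 := by
    rw [spectralComplexity, Finset.prod_pow]
  set P := ∏ l, (specNorm (W l) + 1) with hPdef
  have hP : 0 < P := Finset.prod_pos fun l _ => ha0 l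
  have hb0 : 0 < b := by
    rcases hb.eq_or_lt with h0 | h0
    · rw [← h0] at hW
      norm_num at hW
    · exact h0
  set Q := b * (P - 1) with hQdef
  have hk1 : 8 * Q ≤ roundedScale b W := Int.le_ceil _
  have hk2 : (roundedScale b W : ℝ) < 8 * Q + 1 := Int.ceil_lt_add_one _
  set k := roundedScale b W with hkdef
  set X := b + (k : ℝ) / 8 with hXdef
  have hXP : b * P ≤ X := by
    rw [hXdef]
    linarith
  have hXP' : X ≤ b * P + 1 / 8 := by
    rw [hXdef]
    linarith
  have hX4 : 1 / 4 < X := by linarith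
  have hX2 : X ≤ 2 * (b * P) := by linarith
  set c := encode b W with hcdef
  set S := ∑ l, frobSq (W l) / (specNorm (W l) + 1) ^ 2 with hSdef
  have hS : 0 ≤ S := Finset.sum_nonneg fun l _ => div_nonneg (frobSq_nonneg _) (by positivity)
  set Φ := spectralComplexity W
  have hΦ0 : 0 ≤ Φ := by
    rw [hΦ]
    positivity
  set K := b ^ 2 * d ^ 2 * h ^ 2 * Φ with hK
  have hK0 : 0 ≤ K := by positivity
  have hdh : (1 : ℝ) ≤ d * h ^ 2 := one_le_mul_of_one_le_of_one_le hd' (one_le_pow₀ hh')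
  -- With `Q > 1/4`, this lets `K` absorb the constant cost of all `d h²` matrix entries.
  have hQK : d * h ^ 2 * Q ^ 2 ≤ K := by
    calc d * h ^ 2 * Q ^ 2 ≤ d * h ^ 2 * (b ^ 2 * d * Φ) := by gcongr
      _ = K := by
        rw [hK]
        ring
  have hdhK : (d : ℝ) * h ^ 2 ≤ 16 * K := by
    have hQ16 : 1 / 16 ≤ Q ^ 2 := by nlinarith
    nlinarith
  have hQK' : Q ^ 2 ≤ K := (le_mul_of_one_le_left (sq_nonneg Q) hdh).trans hQK
  have hX0 : 0 < X := by linarith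
  have hX2K : X ^ 2 * d ^ 2 * h ^ 2 * S ≤ 4 * K := by
    calc X ^ 2 * d ^ 2 * h ^ 2 * S ≤ (2 * (b * P)) ^ 2 * d ^ 2 * h ^ 2 * S := by gcongr
      _ = 4 * K := by
        rw [hK, hΦ]
        ring
  have hcτ : ∑ l : Fin d, (((|c (Sum.inr (Sum.inl l))| : ℤ) : ℝ) + 2) ≤ 9216 * K + 4 * d := by
    refine (sum_abs_floor_skip_le W hX0 hd).trans ?_
    have : X ^ 2 * d ^ 2 * S ≤ X ^ 2 * d ^ 2 * S * h ^ 2 :=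
      le_mul_of_one_le_right (by positivity) (one_le_pow₀ hh')
    linarith
  have hcV : ∑ q : Fin d × Fin h × Fin h, (((|c (Sum.inr (Sum.inr q))| : ℤ) : ℝ) + 2)
      ≤ 9216 * K + 4 * (d * h ^ 2) := by
    refine (sum_abs_floor_entry_le W hX0 hd hh).trans ?_
    linarith
  have hck : ((|k| : ℤ) : ℝ) + 2 ≤ 16 * K + 4 := by
    have hkpos : (0 : ℝ) ≤ k := by linarith
    rw [Int.cast_abs, abs_of_nonneg hkpos]
    nlinarith [sq_nonneg (4 * Q - 1)]
  have hddh : (d : ℝ) ≤ d * h ^ 2 := le_mul_of_one_le_right (by positivity) (one_le_pow₀ hh')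
  rw [Fintype.sum_sum_type, Fintype.sum_sum_type]
  have hcu : ∑ u : Unit, (((|c (Sum.inl u)| : ℤ) : ℝ) + 2) = ((|k| : ℤ) : ℝ) + 2 := by
    simp [hcdef, encode, hkdef]
  rw [hcu]
  linarith

end Quantization

/-! ### Margin losses, Hoeffding and the Kraft-weighted union bound. -/

section Concentration

open ProbabilityTheory
open scoped ENNReal

variable {h m : ℕ}

theorem pointLoss_nonneg (γ : ℝ) (f : EuclideanSpace ℝ (Fin h) → EuclideanSpace ℝ (Fin h))
    (z : EuclideanSpace ℝ (Fin h) × Fin h) : 0 ≤ pointLoss γ f z := by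
  rw [pointLoss]
  split_ifs <;> norm_num

theorem pointLoss_le_one (γ : ℝ) (f : EuclideanSpace ℝ (Fin h) → EuclideanSpace ℝ (Fin h))
    (z : EuclideanSpace ℝ (Fin h) × Fin h) : pointLoss γ f z ≤ 1 := by
  rw [pointLoss]
  split_ifs <;> norm_num

theorem measurable_pointLoss (γ : ℝ) {f : EuclideanSpace ℝ (Fin h) → EuclideanSpace ℝ (Fin h)}
    (hf : Continuous f) : Measurable (pointLoss γ f) := by
  classical
  refine measurable_from_prod_countable_left fun y => ?_
  simp only [pointLoss]
  have hcoord : ∀ j, Measurable fun x => f x j := fun j =>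
    ((EuclideanSpace.proj (𝕜 := ℝ) j).continuous.comp hf).measurable
  refine Measurable.ite ?_ measurable_const measurable_const
  simp only [Set.ofPred_exists, Set.ofPred_and]
  exact MeasurableSet.iUnion fun j => (MeasurableSet.const _).inter
    (measurableSet_le (hcoord y) ((hcoord j).const_add γ))

/-- Two coordinates, each moved by at most `r`, change a score difference by at most `2r`. -/
theorem pointLoss_le_pointLoss_of_near {γ γ' r : ℝ}
    {f g : EuclideanSpace ℝ (Fin h) → EuclideanSpace ℝ (Fin h)}
    {z : EuclideanSpace ℝ (Fin h) × Fin h} (hfg : ‖g z.1 - f z.1‖ ≤ r) (hγ : γ + 2 * r ≤ γ') :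
    pointLoss γ f z ≤ pointLoss γ' g z := by
  by_cases hf : ∃ j, j ≠ z.2 ∧ f z.1 z.2 ≤ γ + f z.1 j
  · obtain ⟨j, hj, hle⟩ := hf
    have hcoord : ∀ i, |g z.1 i - f z.1 i| ≤ r := fun i =>
      (PiLp.norm_apply_le (g z.1 - f z.1) i).trans hfg
    have h1 := abs_le.1 (hcoord j)
    have h2 := abs_le.1 (hcoord z.2)
    have hg : ∃ j, j ≠ z.2 ∧ g z.1 z.2 ≤ γ' + g z.1 j := ⟨j, hj, by linarith⟩
    rw [pointLoss, pointLoss, if_pos hg]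
    split_ifs <;> norm_num
  · rw [pointLoss, if_neg hf]
    exact pointLoss_nonneg _ _ _

theorem integrable_pointLoss (D : Measure (EuclideanSpace ℝ (Fin h) × Fin h))
    [IsProbabilityMeasure D] (γ : ℝ) {f : EuclideanSpace ℝ (Fin h) → EuclideanSpace ℝ (Fin h)}
    (hf : Continuous f) : Integrable (pointLoss γ f) D :=
  Integrable.of_mem_Icc 0 1 (measurable_pointLoss γ hf).aemeasurable
    (ae_of_all _ fun z => ⟨pointLoss_nonneg γ f z, pointLoss_le_one γ f z⟩)

theorem expectedLoss_le_one (D : Measure (EuclideanSpace ℝ (Fin h) × Fin h))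
    [IsProbabilityMeasure D] (γ : ℝ) (f : EuclideanSpace ℝ (Fin h) → EuclideanSpace ℝ (Fin h)) :
    expectedLoss D γ f ≤ 1 := by
  have := integral_mono_of_nonneg (μ := D) (ae_of_all _ (pointLoss_nonneg γ f))
    (integrable_const (1 : ℝ)) (ae_of_all _ (pointLoss_le_one γ f))
  simpa [expectedLoss] using this

theorem empiricalLoss_nonneg (S : Fin m → EuclideanSpace ℝ (Fin h) × Fin h) (γ : ℝ)
    (f : EuclideanSpace ℝ (Fin h) → EuclideanSpace ℝ (Fin h)) : 0 ≤ empiricalLoss S γ f :=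
  div_nonneg (Finset.sum_nonneg fun _ _ => pointLoss_nonneg _ _ _) (Nat.cast_nonneg _)

/-- A margin bound for `g` transfers to every network that is close to `g` on the ball. -/
theorem expectedLoss_le_of_near (D : Measure (EuclideanSpace ℝ (Fin h) × Fin h))
    [IsProbabilityMeasure D] {B γ ε : ℝ} (hD : ∀ᵐ z ∂D, ‖z.1‖ ≤ B)
    {f g : EuclideanSpace ℝ (Fin h) → EuclideanSpace ℝ (Fin h)} (hg : Continuous g)
    (hfg : ∀ x, ‖x‖ ≤ B → ‖g x - f x‖ ≤ γ / 4)
    {S : Fin m → EuclideanSpace ℝ (Fin h) × Fin h} (hS : ∀ i, ‖(S i).1‖ ≤ B)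
    (hgS : expectedLoss D (γ / 2) g ≤ empiricalLoss S (γ / 2) g + ε) :
    expectedLoss D 0 f ≤ empiricalLoss S γ f + ε := by
  have h1 : expectedLoss D 0 f ≤ expectedLoss D (γ / 2) g := by
    refine integral_mono_of_nonneg (ae_of_all _ (pointLoss_nonneg 0 f))
      (integrable_pointLoss D (γ / 2) hg) ?_
    filter_upwards [hD] with z hz
    exact pointLoss_le_pointLoss_of_near (hfg _ hz) (by linarith)
  have h2 : empiricalLoss S (γ / 2) g ≤ empiricalLoss S γ f := by
    refine div_le_div_of_nonneg_right (Finset.sum_le_sum fun i _ => ?_) (Nat.cast_nonneg _)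
    refine pointLoss_le_pointLoss_of_near (r := γ / 4) ?_ (by linarith)
    rw [norm_sub_rev]
    exact hfg _ (hS i)
  linarith

/-- Hoeffding's inequality for the empirical margin loss of a fixed score function. -/
theorem measure_empiricalLoss_add_le_expectedLoss_le
    (D : Measure (EuclideanSpace ℝ (Fin h) × Fin h)) [IsProbabilityMeasure D] (hm : 1 ≤ m) (γ : ℝ)
    {f : EuclideanSpace ℝ (Fin h) → EuclideanSpace ℝ (Fin h)} (hf : Continuous f) {ε : ℝ}
    (hε : 0 ≤ ε) :
    Measure.pi (fun _ : Fin m => D) {S | empiricalLoss S γ f + ε ≤ expectedLoss D γ f}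
      ≤ ENNReal.ofReal (Real.exp (-(2 * m * ε ^ 2))) := by
  have hm0 : (0 : ℝ) < m := by exact_mod_cast hm
  have hmeas := (measurable_pointLoss γ hf).const_sub (expectedLoss D γ f)
  set X : EuclideanSpace ℝ (Fin h) × Fin h → ℝ := fun z => expectedLoss D γ f - pointLoss γ f z
    with hX
  have hindep : iIndepFun (fun (i : Fin m) (S : Fin m → EuclideanSpace ℝ (Fin h) × Fin h) =>
      X (S i)) (Measure.pi fun _ => D) := iIndepFun_pi fun _ => hmeas.aemeasurable
  -- The centred loss lies in an interval of length `1`, which gives the variance proxy `1/4`.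
  have hsub : HasSubgaussianMGF X ((‖expectedLoss D γ f - (expectedLoss D γ f - 1)‖₊ / 2) ^ 2) D := by
    refine hasSubgaussianMGF_of_mem_Icc_of_integral_eq_zero hmeas.aemeasurable
      (ae_of_all _ fun z => ⟨?_, ?_⟩) ?_
    · simp only [hX]
      linarith [pointLoss_le_one γ f z]
    · simp only [hX]
      linarith [pointLoss_nonneg γ f z]
    · simp only [hX]
      rw [integral_sub (integrable_const _) (integrable_pointLoss D γ hf)]
      simp [expectedLoss]
  have hsub' : ∀ i ∈ (Finset.univ : Finset (Fin m)), HasSubgaussianMGF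
      (fun S : Fin m → EuclideanSpace ℝ (Fin h) × Fin h => X (S i)) ((1 / 2) ^ 2)
      (Measure.pi fun _ => D) := fun i _ => by
    have hmp := measurePreserving_eval (fun _ : Fin m => D) i
    rw [← hmp.map_eq] at hsub
    have := hsub.of_map hmp.measurable.aemeasurable
    simpa [Function.comp_def] using this
  have hoeff := HasSubgaussianMGF.measure_sum_ge_le_of_iIndepFun hindep hsub'
    (ε := m * ε) (by positivity)
  have hset : {S : Fin m → EuclideanSpace ℝ (Fin h) × Fin h |
      empiricalLoss S γ f + ε ≤ expectedLoss D γ f} = {S | m * ε ≤ ∑ i, X (S i)} := by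
    ext S
    simp only [Set.mem_ofPred_eq, hX, Finset.sum_sub_distrib, Finset.sum_const, Finset.card_univ,
      Fintype.card_fin, nsmul_eq_mul, empiricalLoss]
    rw [← mul_le_mul_iff_right₀ hm0, mul_add, mul_div_cancel₀ _ hm0.ne']
    constructor <;> intro h <;> linarith
  rw [hset, ← ofReal_measureReal]
  refine ENNReal.ofReal_le_ofReal (hoeff.trans (le_of_eq ?_))
  congr 1
  simp
  field_simp

/-- A weighted union bound: a countable family of score functions with prefix-code lengths
`len i` satisfies simultaneous generalization bounds. -/
theorem measure_exists_empiricalLoss_add_le_expectedLoss_le {ι : Type*} [Countable ι]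
    (D : Measure (EuclideanSpace ℝ (Fin h) × Fin h)) [IsProbabilityMeasure D] (hm : 1 ≤ m) (γ : ℝ)
    {f : ι → EuclideanSpace ℝ (Fin h) → EuclideanSpace ℝ (Fin h)} (hf : ∀ i, Continuous (f i))
    (len : ι → ℕ) (hlen : ∑' i, (2⁻¹ : ℝ≥0∞) ^ len i ≤ 1) {η : ℝ} (hη0 : 0 < η) (hη1 : η ≤ 1) :
    Measure.pi (fun _ : Fin m => D) {S | ∃ i, empiricalLoss S γ (f i)
        + √((Real.log (1 / η) + Real.log 2 * len i) / (2 * m)) ≤ expectedLoss D γ (f i)}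
      ≤ ENNReal.ofReal η := by
  have hm0 : (0 : ℝ) < m := by exact_mod_cast hm
  have hlog : 0 ≤ Real.log (1 / η) := Real.log_nonneg (by rw [le_div_iff₀ hη0]; linarith)
  rw [Set.ofPred_exists]
  calc _ ≤ ∑' i, Measure.pi (fun _ : Fin m => D) {S | empiricalLoss S γ (f i)
        + √((Real.log (1 / η) + Real.log 2 * len i) / (2 * m)) ≤ expectedLoss D γ (f i)} :=
        measure_iUnion_le _
    _ ≤ ∑' i, ENNReal.ofReal η * (2⁻¹ : ℝ≥0∞) ^ len i := by
        refine ENNReal.tsum_le_tsum fun i => ?_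
        refine (measure_empiricalLoss_add_le_expectedLoss_le D hm γ (hf i)
          (Real.sqrt_nonneg _)).trans (le_of_eq ?_)
        have hexp : Real.exp (-(2 * m *
            √((Real.log (1 / η) + Real.log 2 * len i) / (2 * m)) ^ 2)) = η * 2⁻¹ ^ len i := by
          have hlog2 : 0 ≤ Real.log 2 := Real.log_nonneg (by norm_num)
          rw [Real.sq_sqrt (by positivity), mul_div_cancel₀ _ (by positivity), one_div,
            Real.log_inv, neg_add, neg_neg, Real.exp_add, Real.exp_log hη0, mul_comm (Real.log 2),
            Real.exp_neg, Real.exp_nat_mul, Real.exp_log two_pos, inv_pow]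
        rw [hexp, ENNReal.ofReal_mul hη0.le, ENNReal.ofReal_pow (by norm_num),
          ENNReal.ofReal_inv_of_pos two_pos]
        norm_num
    _ ≤ ENNReal.ofReal η := by
        rw [ENNReal.tsum_mul_left]
        exact mul_le_of_le_one_right' hlen

/-- Kraft's inequality for one integer: the extra `2` in the exponent makes each half-line
contribute at most `1/2`. -/
theorem tsum_int_inv_two_pow_natAbs_le : ∑' n : ℤ, (2⁻¹ : ℝ≥0∞) ^ (n.natAbs + 2) ≤ 1 := by
  have h4 : (2⁻¹ : ℝ≥0∞) ^ 2 * 2 + (2⁻¹ : ℝ≥0∞) ^ 2 * 2 = 1 := by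
    rw [← two_mul, sq, mul_assoc, ENNReal.inv_mul_cancel (by norm_num) (by norm_num), mul_one,
      ENNReal.mul_inv_cancel (by norm_num) (by norm_num)]
  have hgeom : ∑' n : ℕ, (2⁻¹ : ℝ≥0∞) ^ n = 2 := by
    rw [ENNReal.tsum_geometric, ENNReal.one_sub_inv_two, inv_inv]
  have h1 : ∑' n : ℕ, (2⁻¹ : ℝ≥0∞) ^ ((n : ℤ).natAbs + 2) = (2⁻¹ : ℝ≥0∞) ^ 2 * 2 := by
    simp_rw [Int.natAbs_natCast, pow_add, mul_comm _ ((2⁻¹ : ℝ≥0∞) ^ 2)]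
    rw [ENNReal.tsum_mul_left, hgeom]
  have h2 : ∑' n : ℕ, (2⁻¹ : ℝ≥0∞) ^ ((-((n : ℤ) + 1)).natAbs + 2) ≤ (2⁻¹ : ℝ≥0∞) ^ 2 * 2 := by
    rw [← h1]
    refine ENNReal.tsum_le_tsum fun n => ?_
    exact pow_le_pow_right_of_le_one' (by norm_num) (by omega)
  rw [tsum_of_nat_of_neg_add_one ENNReal.summable ENNReal.summable, ← h4]
  exact add_le_add h1.le h2

theorem tsum_pi_prod_le_one {ι κ : Type*} [Fintype ι] (p : κ → ℝ≥0∞) (hp : ∑' n, p n ≤ 1) :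
    ∑' c : ι → κ, ∏ j, p (c j) ≤ 1 := by
  classical
  rw [ENNReal.tsum_eq_iSup_sum]
  refine iSup_le fun s => ?_
  -- A finite set of codes lies in the box of its coordinate projections, over which the sum
  -- factors.
  calc ∑ c ∈ s, ∏ j, p (c j)
      ≤ ∑ c ∈ Fintype.piFinset fun j => s.image fun c => c j, ∏ j, p (c j) := by
        refine Finset.sum_le_sum_of_subset fun c hc => ?_
        exact Fintype.mem_piFinset.2 fun j => Finset.mem_image_of_mem (fun c => c j) hc
    _ = ∏ j : ι, ∑ n ∈ s.image fun c => c j, p n := (Finset.prod_univ_sum _ _).symm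
    _ ≤ 1 := Finset.prod_le_one' fun j _ => (ENNReal.sum_le_tsum _).trans hp

theorem tsum_inv_two_pow_sum_natAbs_le {ι : Type*} [Fintype ι] :
    ∑' c : ι → ℤ, (2⁻¹ : ℝ≥0∞) ^ (∑ j, ((c j).natAbs + 2)) ≤ 1 := by
  simp_rw [← Finset.prod_pow_eq_pow_sum]
  exact tsum_pi_prod_le_one _ tsum_int_inv_two_pow_natAbs_le

theorem ae_forall_norm_le (D : Measure (EuclideanSpace ℝ (Fin h) × Fin h))
    [IsProbabilityMeasure D] {B : ℝ} (hD : ∀ᵐ z ∂D, ‖z.1‖ ≤ B) :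
    Measure.pi (fun _ : Fin m => D) {S | ¬ ∀ i, ‖(S i).1‖ ≤ B} = 0 := by
  rw [← ae_iff, ae_all_iff]
  exact fun i => (Measure.quasiMeasurePreserving_eval (fun _ : Fin m => D) i).ae hD

end Concentration

/-! ### Assembling the generalization bound. -/

section Generalization

variable {d h m : ℕ}

theorem spectralComplexity_nonneg (W : Weights d h) : 0 ≤ spectralComplexity W :=
  mul_nonneg (Finset.prod_nonneg fun _ _ => sq_nonneg _)
    (Finset.sum_nonneg fun _ _ => div_nonneg (frobSq_nonneg _) (sq_nonneg _))

/-- The constant is `10000 = 20000 / 2`: the code-length constant over Hoeffding's `2`. Its root is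
the final `100`. The maximum with `γ²` keeps the coefficient of `t` at least `1` after division by
`γ²`. -/
theorem sqrt_le_error_term {B γ K t s : ℝ} {n : ℕ} (hγ : 0 < γ) (ht : 0 ≤ t)
    (hs : s ≤ 10000 * ((B / γ) ^ 2 * K + t)) :
    √(s / n) ≤ 100 * √((B ^ 2 * K + max 1 (γ ^ 2) * t) / (γ ^ 2 * n)) := by
  have h100 : (100 : ℝ) = √10000 := by
    rw [show (10000 : ℝ) = 100 ^ 2 by norm_num, Real.sqrt_sq (by norm_num)]
  rw [h100, ← Real.sqrt_mul (by norm_num)]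
  refine Real.sqrt_le_sqrt ?_
  have hK : (B / γ) ^ 2 * K + t ≤ (B ^ 2 * K + max 1 (γ ^ 2) * t) / γ ^ 2 := by
    rw [le_div_iff₀ (by positivity), add_mul]
    have h1 : (B / γ) ^ 2 * K * γ ^ 2 = B ^ 2 * K := by field_simp
    have h2 := mul_le_mul_of_nonneg_right (le_max_right 1 (γ ^ 2)) ht
    linarith
  rw [← div_div, ← mul_div_assoc]
  exact div_le_div_of_nonneg_right (by linarith) (Nat.cast_nonneg _)

theorem measure_not_forall_expectedLoss_le (hd : 1 ≤ d) (hh : 1 ≤ h) (hm : 1 ≤ m) {B γ δ : ℝ}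
    (hB : 0 ≤ B) (hγ : 0 < γ) (hδ : 0 < δ) (D : Measure (EuclideanSpace ℝ (Fin h) × Fin h))
    [IsProbabilityMeasure D] (hD : ∀ᵐ z ∂D, ‖z.1‖ ≤ B) :
    Measure.pi (fun _ : Fin m => D)
        {S | ¬ ∀ W : Weights d h, expectedLoss D 0 (resNet d W) ≤
          empiricalLoss S γ (resNet d W) +
            100 * √((B ^ 2 * (d : ℝ) ^ 2 * (h : ℝ) ^ 2 * spectralComplexity W
              + max 1 (γ ^ 2) * Real.log ((d : ℝ) * m / δ)) / (γ ^ 2 * m))}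
      ≤ ENNReal.ofReal δ := by
  rcases le_or_gt 1 δ with hδ1 | hδ1
  · exact prob_le_one.trans (by simpa using ENNReal.ofReal_le_ofReal hδ1)
  have hd' : (1 : ℝ) ≤ d := by exact_mod_cast hd
  have hm' : (1 : ℝ) ≤ m := by exact_mod_cast hm
  set t := Real.log ((d : ℝ) * m / δ) with ht
  have hmt : Real.log (m / δ) ≤ t := by
    refine Real.log_le_log (by positivity) ?_
    gcongr
    exact le_mul_of_one_le_left (by positivity) hd'
  have hδt : Real.log (1 / δ) ≤ t :=
    (Real.log_le_log (by positivity) (by gcongr)).trans hmt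
  have ht0 : 0 ≤ t := (Real.log_nonneg (by rw [le_div_iff₀ hδ]; linarith)).trans hδt
  have hKnonneg : ∀ W : Weights d h, 0 ≤ (d : ℝ) ^ 2 * (h : ℝ) ^ 2 * spectralComplexity W :=
    fun W => mul_nonneg (by positivity) (spectralComplexity_nonneg W)
  have hassoc : ∀ W : Weights d h, B ^ 2 * (d : ℝ) ^ 2 * (h : ℝ) ^ 2 * spectralComplexity W
      = B ^ 2 * ((d : ℝ) ^ 2 * (h : ℝ) ^ 2 * spectralComplexity W) := fun W => by ring
  have hcost : ∀ W : Weights d h, 1 / 4 < B / γ * ((∏ l, (specNorm (W l) + 1)) - 1) →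
      ∑ j, (((|encode (B / γ) W j| : ℤ) : ℝ) + 2)
        ≤ 20000 * ((B / γ) ^ 2 * ((d : ℝ) ^ 2 * (h : ℝ) ^ 2 * spectralComplexity W)) :=
    fun W hW => (sum_abs_encode_le hd hh (by positivity) W hW).trans (le_of_eq (by ring))
  simp_rw [hassoc]
  set bound : Weights d h → ℝ := fun W =>
    100 * √((B ^ 2 * ((d : ℝ) ^ 2 * (h : ℝ) ^ 2 * spectralComplexity W)
      + max 1 (γ ^ 2) * t) / (γ ^ 2 * m)) with hbound
  -- The identity is the centre for all networks close to it.
  set idBad : ℝ → Set (Fin m → EuclideanSpace ℝ (Fin h) × Fin h) := fun η =>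
    {S | ∃ _u : Unit, empiricalLoss S (γ / 2) id
      + √((Real.log (1 / η) + Real.log 2 * (0 : ℕ)) / (2 * m)) ≤ expectedLoss D (γ / 2) id}
    with hidBad
  have hid : ∀ η, 0 < η → η ≤ 1 → Measure.pi (fun _ : Fin m => D) (idBad η) ≤ ENNReal.ofReal η :=
    fun η h0 h1 => measure_exists_empiricalLoss_add_le_expectedLoss_le (ι := Unit) D hm (γ / 2)
      (f := fun _ => id) (fun _ => continuous_id) (fun _ => 0) (by simp) h0 h1
  have hidGood : ∀ η S, Real.log (1 / η) ≤ t → S ∉ idBad η → (∀ i, ‖(S i).1‖ ≤ B) →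
      ∀ W : Weights d h, B / γ * ((∏ l, (specNorm (W l) + 1)) - 1) ≤ 1 / 4 →
        expectedLoss D 0 (resNet d W) ≤ empiricalLoss S γ (resNet d W) + bound W := by
    intro η S hη hS hSB W hW
    refine expectedLoss_le_of_near D hD continuous_id (fun x hx => ?_) hSB ?_
    · rw [id, norm_sub_rev]
      refine (norm_resNet_sub_self_le d W x).trans ?_
      have hP : 1 ≤ ∏ l, (specNorm (W l) + 1) :=
        Finset.prod_induction _ (1 ≤ ·) (fun _ _ => one_le_mul_of_one_le_of_one_le) le_rfl
          fun l _ => by linarith [specNorm_nonneg (W l)]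
      calc ((∏ l, (specNorm (W l) + 1)) - 1) * ‖x‖
          ≤ ((∏ l, (specNorm (W l) + 1)) - 1) * B :=
            mul_le_mul_of_nonneg_left hx (by linarith)
        _ = B / γ * ((∏ l, (specNorm (W l) + 1)) - 1) * γ := by
            field_simp
        _ ≤ 1 / 4 * γ := by gcongr
        _ = γ / 4 := by ring
    · have hS' := not_le.1 fun hle => hS ⟨(), hle⟩
      refine hS'.le.trans (add_le_add le_rfl ?_)
      rw [← div_div]
      refine sqrt_le_error_term hγ ht0 ?_
      have := mul_nonneg (sq_nonneg (B / γ)) (hKnonneg W)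
      push_cast
      linarith
  have hnull := ae_forall_norm_le (m := m) D hD
  -- Sharing `δ` between the identity and the codes costs `log (2 / δ)`, which `log (m / δ)` covers
  -- only for `m ≥ 2`.
  rcases hm.eq_or_lt with hm1 | hm2
  · -- With one sample the bound is trivial away from the identity.
    refine (measure_mono (t := {S | ¬ ∀ i, ‖(S i).1‖ ≤ B} ∪ idBad δ) ?_).trans
      ((measure_union_le _ _).trans ?_)
    · intro S hS
      by_contra hcon
      rw [Set.mem_union, not_or, Set.mem_ofPred_eq, not_not] at hcon
      refine hS fun W => ?_
      rcases le_or_gt (B / γ * ((∏ l, (specNorm (W l) + 1)) - 1)) (1 / 4) with hW | hW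
      · exact hidGood δ S hδt hcon.2 hcon.1 W hW
      -- The scale coordinate alone costs `2` bits, which already forces the error term to be at
      -- least `1`.
      · have h2 : 2 ≤ ∑ j, (((|encode (B / γ) W j| : ℤ) : ℝ) + 2) := by
          have := Finset.single_le_sum (s := Finset.univ)
            (f := fun j => ((|encode (B / γ) W j| : ℤ) : ℝ) + 2)
            (fun j _ => by positivity) (Finset.mem_univ (Sum.inl ()))
          refine le_trans ?_ this
          have : (0 : ℝ) ≤ ((|encode (B / γ) W (Sum.inl ())| : ℤ) : ℝ) := by positivity
          linarith
        have hm1' : (m : ℝ) = 1 := by exact_mod_cast hm1.symm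
        have h1 : (1 : ℝ) ≤ bound W := by
          have := sqrt_le_error_term (n := m) hγ ht0 (s := m)
            (K := (d : ℝ) ^ 2 * (h : ℝ) ^ 2 * spectralComplexity W) (B := B)
            (by linarith [hcost W hW])
          rwa [div_self (by positivity), Real.sqrt_one] at this
        exact (expectedLoss_le_one D 0 _).trans
          (h1.trans (le_add_of_nonneg_left (empiricalLoss_nonneg _ _ _)))
    · rw [hnull, zero_add]
      exact hid δ hδ hδ1.le
  · have hη : Real.log (1 / (δ / 2)) ≤ t := by
      refine le_trans (Real.log_le_log (by positivity) ?_) hmt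
      have : (2 : ℝ) ≤ m := by exact_mod_cast hm2
      rw [one_div_div]
      gcongr
    set codeBad : Set (Fin m → EuclideanSpace ℝ (Fin h) × Fin h) :=
      {S | ∃ c : CodeIndex d h → ℤ, empiricalLoss S (γ / 2) (codeNet (B / γ) c)
        + √((Real.log (1 / (δ / 2)) + Real.log 2 * (∑ j, ((c j).natAbs + 2) : ℕ)) / (2 * m))
          ≤ expectedLoss D (γ / 2) (codeNet (B / γ) c)} with hcodeBad
    have hcode : Measure.pi (fun _ : Fin m => D) codeBad ≤ ENNReal.ofReal (δ / 2) :=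
      measure_exists_empiricalLoss_add_le_expectedLoss_le D hm (γ / 2)
        (fun c => continuous_codeNet (B / γ) c) _ tsum_inv_two_pow_sum_natAbs_le
        (by positivity) (by linarith)
    refine (measure_mono (t := {S | ¬ ∀ i, ‖(S i).1‖ ≤ B} ∪ (idBad (δ / 2) ∪ codeBad)) ?_).trans
      ((measure_union_le _ _).trans ?_)
    · intro S hS
      by_contra hcon
      rw [Set.mem_union, not_or, Set.mem_union, not_or, Set.mem_ofPred_eq, not_not] at hcon
      refine hS fun W => ?_
      rcases le_or_gt (B / γ * ((∏ l, (specNorm (W l) + 1)) - 1)) (1 / 4) with hW | hW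
      · exact hidGood (δ / 2) S hη hcon.2.1 hcon.1 W hW
      · refine expectedLoss_le_of_near D hD (continuous_codeNet (B / γ) (encode (B / γ) W))
          (norm_codeNet_encode_sub_le hd hh hB hγ W hW) hcon.1 ?_
        have hS' := not_le.1 fun hle => hcon.2.2 ⟨encode (B / γ) W, hle⟩
        refine hS'.le.trans (add_le_add le_rfl ?_)
        rw [← div_div]
        refine sqrt_le_error_term hγ ht0 ?_
        have hlen : ((∑ j, ((encode (B / γ) W j).natAbs + 2) : ℕ) : ℝ)
            = ∑ j, (((|encode (B / γ) W j| : ℤ) : ℝ) + 2) := by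
          push_cast
          refine Finset.sum_congr rfl fun j _ => ?_
          rw [Nat.cast_natAbs, Int.cast_abs]
        have hc := hcost W hW
        have hpos := mul_nonneg (sq_nonneg (B / γ)) (hKnonneg W)
        -- Bits are converted to nats at a factor of at most `1`.
        have hlog2 : Real.log 2 ≤ 1 := (Real.log_le_sub_one_of_pos two_pos).trans (by norm_num)
        have := mul_le_mul_of_nonneg_right hlog2
          (Nat.cast_nonneg (α := ℝ) (∑ j, ((encode (B / γ) W j).natAbs + 2)))
        rw [hlen] at this ⊢
        linarith
    · rw [hnull, zero_add]
      calc _ ≤ ENNReal.ofReal (δ / 2) + ENNReal.ofReal (δ / 2) :=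
            (measure_union_le _ _).trans
              (add_le_add (hid (δ / 2) (by positivity) (by linarith)) hcode)
        _ = ENNReal.ofReal δ := by
            rw [← ENNReal.ofReal_add (by positivity) (by positivity), add_halves]

end Generalization

end ResNetBound

/-- First part: the matrices `A_l` are sensitivity matrices, that is, they dominate the change of
the network output under layerwise weight perturbations. Second part: the generalization bound,
with one absolute constant `C`; the set of samples for which it fails for some `w` has (outer)
probability at most `δ`. -/
theorem corollary1 :
    (∀ (d h : ℕ) (B : ℝ), 1 ≤ d → 1 ≤ h → 0 ≤ B →
      ∀ (W U : ResNetBound.Weights d h),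
        (∀ l, ResNetBound.specNorm (U l) ≤ (ResNetBound.specNorm (W l) + 1) / d) →
        ∀ x : EuclideanSpace ℝ (Fin h), ‖x‖ ≤ B →
          ∀ k : Fin h,
            |ResNetBound.resNet d (W + U) x k - ResNetBound.resNet d W x k| ^ 2 ≤
              ∑ l, ‖WithLp.toLp 2
                (ResNetBound.sensitivity B W l *ᵥ Matrix.vec (U l))‖ ^ 2) ∧
    ∃ C : ℝ, 0 < C ∧
      ∀ (d h m : ℕ) (B γ δ : ℝ), 1 ≤ d → 1 ≤ h → 1 ≤ m → 0 ≤ B → 0 < γ → 0 < δ →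
        ∀ (D : Measure (EuclideanSpace ℝ (Fin h) × Fin h)), IsProbabilityMeasure D →
          (∀ᵐ z ∂D, ‖z.1‖ ≤ B) →
          (Measure.pi (fun _ : Fin m => D))
            {S | ¬ ∀ W : ResNetBound.Weights d h,
              ResNetBound.expectedLoss D 0 (ResNetBound.resNet d W) ≤
                ResNetBound.empiricalLoss S γ (ResNetBound.resNet d W) +
                  C * √((B ^ 2 * (d : ℝ) ^ 2 * (h : ℝ) ^ 2 * ResNetBound.spectralComplexity W
                      + max 1 (γ ^ 2) * Real.log ((d : ℝ) * m / δ)) / (γ ^ 2 * m))}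
            ≤ ENNReal.ofReal δ := by
  refine ⟨fun d h B hd _ _ W U hU x hx k => ?_, 100, by norm_num, ?_⟩
  · exact ResNetBound.sq_abs_resNet_add_sub_le d h B W U hU x hx k
  · intro d h m B γ δ hd hh hm hB hγ hδ D _ hD
    exact ResNetBound.measure_not_forall_expectedLoss_le hd hh hm hB hγ hδ D hD
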